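/- Let $I=(0,1)$, $e_3=(0,0,1)$, let $a\in\mathbb R^3$ with $|a|=1$, and write $H^n=H^n(I;\mathbb R^3)$ with its usual norm $\|\cdot\|_n$. For $\varepsilon\ge 0$ and $v:I\to\mathbb R^3$ set $Q^\varepsilon_0(v)=v$ and, for $m\ge 1$ (with $Q_j=Q_j^\varepsilon(v)$), $$Q^\varepsilon_m(v)=\sum_{j=0}^{m-1}\binom{m-1}{j}Q_j\times\partial_s^2Q_{m-1-j}+\varepsilon\,\partial_s^2Q_{m-1}+\varepsilon\sum_{j=0}^{m-1}\sum_{k=0}^{m-1-j}\binom{m-1}{j}\binom{m-1-j}{k}(\partial_sQ_j\cdot\partial_sQ_k)\,Q_{m-1-j-k},$$ and $P_m(v)=Q^0_m(v)$. (Thus $P_m(v)$, $Q^\varepsilon_m(v)$ express $\partial_t^m v$ for the limiting problem $v_t=v\times v_{ss}$, respectively the regularized problem $v_t=v\times v_{ss}+\varepsilon v_{ss}+\varepsilon|v_s|^2v$, both with $v(0,t)=a$, $v(1,t)=e_3$.) We say that $v$ satisfies the compatibility condition of order $k$ for the limiting problem if $v\in H^{2k+1}$ and, when $k=0$, $v(0)=a$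 and $v(1)=e_3$, while, when $k\ge 1$, $P_k(v)=0$ at $s=0$ and $s=1$; for the regularized problem $P_k$ is replaced by $Q^\varepsilon_k$. The conditions hold up to order $m$ if they hold for every $0\le k\le m$. Proposition. For every integer $l\ge 0$ there is a constant $C>0$ (depending neither on $\varepsilon$ nor on $a,v_0$) such that the following holds. Let $0\le m\le[\frac{l+3}{2}]$ be an integer (in particular $m=[\frac{l+3}{2}]$ is allowed), let $v_0\in H^{l+3}$ satisfy $|v_0|\equiv 1$ on $I$, and suppose that $v_0$ satisfies the compatibility conditions for the limiting problem up to order $m$. Then there are $\varepsilon_*>0$ and, for each $\varepsilon\in(0,\varepsilon_*]$, a datum $v_0^\varepsilon\in H^{l+3}$ with $|v_0^\varepsilon|\equiv 1$ that satisfies the compatibility conditions for the regularized problem (with parameter $\varepsilon$) up to order $m$ and $\|v_0^\varepsilon\|_{l+3}\le C\|v_0\|_{l+3}$, such that $v_0^\varepsilon\to v_0$ in $H^{l+3}$ as $\varepsilon\to+0$. -/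

import Mathlib

open MeasureTheory Set Filter Topology
open scoped ContDiff

noncomputable section

namespace VortexFilament

/-- The Euclidean space `ℝ³`. -/
abbrev E3 : Type := EuclideanSpace ℝ (Fin 3)

/-- The open interval `I = (0,1)`. -/
def I : Set ℝ := Ioo 0 1

/-- The vector `e₃ = (0,0,1)`. -/
def e3 : E3 := EuclideanSpace.single 2 1

/-- The exterior (cross) product in `ℝ³`. -/
def cross (x y : E3) : E3 := WithLp.toLp 2 (crossProduct x.ofLp y.ofLp)

/-!
Functions on `I` are represented by functions `ℝ → E3`, of which only the values at almost every
point of `I` matter.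
-/

/-- Smooth real functions with compact support contained in `I`. -/
def IsTestFunction (φ : ℝ → ℝ) : Prop :=
  ContDiff ℝ ∞ φ ∧ HasCompactSupport φ ∧ tsupport φ ⊆ I

/-- `g` is the `k`-th derivative of `u` on `I` in the sense of distributions. -/
def IsWeakDeriv (k : ℕ) (u g : ℝ → E3) : Prop :=
  LocallyIntegrableOn u I ∧ LocallyIntegrableOn g I ∧
    ∀ φ : ℝ → ℝ, IsTestFunction φ →
      ∫ s in I, iteratedDeriv k φ s • u s = (-1 : ℝ) ^ k • ∫ s in I, φ s • g s

open Classical in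
/-- The `k`-th distributional derivative `∂ₛᵏ u` on `I` (determined almost everywhere on `I`);
by convention `0` if `u` has no locally integrable distributional derivative of order `k`. -/
def weakDeriv (k : ℕ) (u : ℝ → E3) : ℝ → E3 :=
  if h : ∃ g, IsWeakDeriv k u g then h.choose else 0

/-- `u ∈ Hⁿ(I)`: the distributional derivatives of `u` up to order `n` are in `L²(I)`. -/
def MemH (n : ℕ) (u : ℝ → E3) : Prop :=
  ∀ k ≤ n, ∃ g, IsWeakDeriv k u g ∧ MemLp g 2 (volume.restrict I)

/-- The norm of `Hⁿ(I)`. -/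
def normH (n : ℕ) (u : ℝ → E3) : ℝ :=
  √(∑ k ∈ Finset.range (n + 1), ∫ s in I, ‖weakDeriv k u s‖ ^ 2)

/-- `u` agrees almost everywhere on `I` with a continuous function on `[0,1]` that takes the
value `c` at the point `p`. For `u ∈ H¹(I)` and `p = 0, 1` this says that the trace of `u` at `p`
is `c`. -/
def HasTrace (u : ℝ → E3) (p : ℝ) (c : E3) : Prop :=
  ∃ w : ℝ → E3, ContinuousOn w (Icc 0 1) ∧ u =ᵐ[volume.restrict I] w ∧ w p = c

/-- The expressions `P_m(v)`: `P₀ = v`,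
`P_{m+1} = ∑_{j=0}^{m} binom(m,j) P_j × ∂ₛ² P_{m-j}`. -/
def P (v : ℝ → E3) : ℕ → ℝ → E3
  | 0 => v
  | m + 1 => fun s =>
      ∑ j : Fin (m + 1), (m.choose j : ℝ) • cross (P v j s) (weakDeriv 2 (P v (m - j)) s)

/-- The expressions `Q_m(v)` with parameter `ε`: `Q₀ = v`,
`Q_{m+1} = ∑_{j=0}^{m} binom(m,j) Q_j × ∂ₛ² Q_{m-j} + ε ∂ₛ² Q_m
  + ε ∑_{j=0}^{m} ∑_{k=0}^{m-j} binom(m,j) binom(m-j,k) (∂ₛ Q_j ⬝ ∂ₛ Q_k) Q_{m-j-k}`. -/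
def Q (ε : ℝ) (v : ℝ → E3) : ℕ → ℝ → E3
  | 0 => v
  | m + 1 => fun s =>
      ∑ j : Fin (m + 1), (m.choose j : ℝ) • cross (Q ε v j s) (weakDeriv 2 (Q ε v (m - j)) s)
      + ε • weakDeriv 2 (Q ε v m) s
      + ε • ∑ j : Fin (m + 1), ∑ k : Fin (m - j + 1),
          ((m.choose j : ℝ) * ((m - j).choose k : ℝ) *
            inner ℝ (weakDeriv 1 (Q ε v j) s) (weakDeriv 1 (Q ε v k) s)) • Q ε v (m - j - k) s

/-- The compatibility condition of order `k` for the problem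
`v_t = v × v_ss`, `v(0,t) = a`, `v(1,t) = e₃`. -/
def Compat (a : E3) (v : ℝ → E3) (k : ℕ) : Prop :=
  MemH (2 * k + 1) v ∧
    if k = 0 then HasTrace v 0 a ∧ HasTrace v 1 e3
    else HasTrace (P v k) 0 0 ∧ HasTrace (P v k) 1 0

/-- The compatibility condition of order `k` for the regularized problem
`v_t = v × v_ss + ε v_ss + ε |v_s|² v`, `v(0,t) = a`, `v(1,t) = e₃`. -/
def RegCompat (ε : ℝ) (a : E3) (v : ℝ → E3) (k : ℕ) : Prop :=
  MemH (2 * k + 1) v ∧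
    if k = 0 then HasTrace v 0 a ∧ HasTrace v 1 e3
    else HasTrace (Q ε v k) 0 0 ∧ HasTrace (Q ε v k) 1 0

/-- The compatibility conditions for the limiting problem up to order `m`. -/
def CompatUpTo (a : E3) (v : ℝ → E3) (m : ℕ) : Prop := ∀ k ≤ m, Compat a v k

/-- The compatibility conditions for the regularized problem up to order `m`. -/
def RegCompatUpTo (ε : ℝ) (a : E3) (v : ℝ → E3) (m : ℕ) : Prop := ∀ k ≤ m, RegCompat ε a v k

/-- `|v| ≡ 1` on `I`. -/
def IsUnitField (v : ℝ → E3) : Prop := ∀ᵐ s ∂volume.restrict I, ‖v s‖ = 1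

end VortexFilament

end

/-!
For fields of unit length, the compatibility conditions of the limiting problem imply those of the
regularized problem for every `ε`. So `v₀` itself is a compatible datum for the regularized problem,
and the constant family `v₀^ε = v₀` has all the required properties, with `C = 1`.

The reason is a symmetry. The half turn `R` about `a` (the geodesic symmetry of the sphere at `a`)
is an orientation-preserving isometry, so both evolution equations are invariant under
`v(s) ↦ R v(2p - s)`, and so are the expressions `Q_j` (`classicalQ_halfTurn`). Suppose `v(p) = a`
at the end point `p`.

* The conditions of the limiting problem up to order `m` force the jet of `v` of order `2m` at `p`
  to be invariant under this symmetry (`jetDiff_halfTurn`). Indeed, if `V` and `W` agree at `p` to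
  order `2k - 1` and their `2k`-th derivatives differ by `c`, then
  `Q_k(V)(p) - Q_k(W)(p) = (a × · + ε)ᵏ c` (`jetDiff_classicalQ`). For `ε = 0` and
  `W(s) = R V(2p - s)` the left side vanishes, while `c` is orthogonal to `a`; hence `c = 0`. At odd
  orders the difference `c` is a multiple of `a`, and differentiating `|v|² = 1` gives `c = 0`.
* Conversely, invariance of the jet gives `Q_k(p) = R Q_k(p)` for every `ε`, so that `Q_k(p)` is a
  multiple of `a`. Formally `|v|²` is constant in time (`coeff_timeSeries_dot_eq_zero`), and when
  `Q_1, …, Q_{k-1}` vanish at `p`, the `k`-th time derivative of `|v|²` at `p` is `2 a ⬝ Q_k(p)`.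
  Hence `Q_k(p) = 0` (`classicalQ_eq_zero`).

To apply this to Sobolev functions, `v ∈ H^{2m+1}` is replaced by a representative of class `C^{2m}`
(`MemH.exists_contDiff`, by the du Bois-Reymond lemma), for which distributional and classical
derivatives, and traces and values, coincide.
-/

noncomputable section

namespace VortexFilament

/-! ### Comparison of jets at a point -/

section Jets

variable {E F G : Type*} [NormedAddCommGroup E] [NormedSpace ℝ E] [NormedAddCommGroup F]
  [NormedSpace ℝ F] [NormedAddCommGroup G] [NormedSpace ℝ G]

/-- `f` and `g` are of class `Cⁿ`, have the same derivatives of order less than `n` at `p`, and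
their `n`-th derivatives at `p` differ by `c`. -/
structure JetDiff (p : ℝ) (n : ℕ) (f g : ℝ → E) (c : E) : Prop where
  left : ContDiff ℝ n f
  right : ContDiff ℝ n g
  lower : ∀ i < n, iteratedDeriv i f p = iteratedDeriv i g p
  top : iteratedDeriv n f p - iteratedDeriv n g p = c

variable {p : ℝ} {n : ℕ}

theorem contDiff_natSucc_iff {f : ℝ → E} :
    ContDiff ℝ ((n + 1 : ℕ) : ℕ∞ω) f ↔ Differentiable ℝ f ∧ ContDiff ℝ n (deriv f) := by
  have := contDiff_succ_iff_deriv (𝕜 := ℝ) (n := (n : ℕ∞ω)) (f := f)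
  push_cast
  rw [this]
  simp

theorem jetDiff_zero_iff {f g : ℝ → E} {c : E} :
    JetDiff p 0 f g c ↔ Continuous f ∧ Continuous g ∧ f p - g p = c := by
  constructor
  · intro h
    exact ⟨h.left.continuous, h.right.continuous, by simpa using h.top⟩
  · rintro ⟨h1, h2, h3⟩
    exact ⟨by simpa using h1, by simpa using h2, by simp, by simpa using h3⟩

theorem jetDiff_succ_iff {f g : ℝ → E} {c : E} :
    JetDiff p (n + 1) f g c ↔ Differentiable ℝ f ∧ Differentiable ℝ g ∧ f p = g p ∧
      JetDiff p n (deriv f) (deriv g) c := by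
  constructor
  · intro h
    obtain ⟨hf, hf'⟩ := contDiff_natSucc_iff.1 h.left
    obtain ⟨hg, hg'⟩ := contDiff_natSucc_iff.1 h.right
    refine ⟨hf, hg, by simpa using h.lower 0 (by omega), hf', hg', fun i hi => ?_, ?_⟩
    · simpa [iteratedDeriv_succ'] using h.lower (i + 1) (by omega)
    · simpa [iteratedDeriv_succ'] using h.top
  · rintro ⟨hf, hg, h0, h⟩
    refine ⟨contDiff_natSucc_iff.2 ⟨hf, h.left⟩, contDiff_natSucc_iff.2 ⟨hg, h.right⟩,
      fun i hi => ?_, ?_⟩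
    · cases i with
      | zero => simpa using h0
      | succ i => simpa [iteratedDeriv_succ'] using h.lower i (by omega)
    · simpa [iteratedDeriv_succ'] using h.top

namespace JetDiff

variable {f g f₁ f₂ g₁ g₂ : ℝ → E} {c c₁ c₂ : E}

theorem refl (hf : ContDiff ℝ n f) : JetDiff p n f f 0 :=
  ⟨hf, hf, fun _ _ => rfl, sub_self _⟩

theorem of_lt {k : ℕ} (h : JetDiff p n f g c) (hk : k < n) : JetDiff p k f g 0 :=
  ⟨h.left.of_le (by exact_mod_cast hk.le), h.right.of_le (by exact_mod_cast hk.le),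
    fun i hi => h.lower i (hi.trans hk), sub_eq_zero.2 (h.lower k hk)⟩

theorem of_le {k : ℕ} (h : JetDiff p n f g 0) (hk : k ≤ n) : JetDiff p k f g 0 := by
  rcases hk.lt_or_eq with hk | rfl
  · exact h.of_lt hk
  · exact h

theorem apply_eq (h : JetDiff p n f g 0) : f p = g p := by
  simpa [sub_eq_zero] using (h.of_le (Nat.zero_le n)).top

theorem deriv (h : JetDiff p (n + 1) f g c) : JetDiff p n (deriv f) (deriv g) c :=
  (jetDiff_succ_iff.1 h).2.2.2

theorem add (h₁ : JetDiff p n f₁ g₁ c₁) (h₂ : JetDiff p n f₂ g₂ c₂) :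
    JetDiff p n (fun s => f₁ s + f₂ s) (fun s => g₁ s + g₂ s) (c₁ + c₂) := by
  have e₁ (i : ℕ) (hi : i ≤ n) : iteratedDeriv i (fun s => f₁ s + f₂ s) p =
      iteratedDeriv i f₁ p + iteratedDeriv i f₂ p :=
    iteratedDeriv_fun_add (h₁.left.of_le (by exact_mod_cast hi)).contDiffAt
      (h₂.left.of_le (by exact_mod_cast hi)).contDiffAt
  have e₂ (i : ℕ) (hi : i ≤ n) : iteratedDeriv i (fun s => g₁ s + g₂ s) p =
      iteratedDeriv i g₁ p + iteratedDeriv i g₂ p :=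
    iteratedDeriv_fun_add (h₁.right.of_le (by exact_mod_cast hi)).contDiffAt
      (h₂.right.of_le (by exact_mod_cast hi)).contDiffAt
  refine ⟨h₁.left.add h₂.left, h₁.right.add h₂.right, fun i hi => ?_, ?_⟩
  · rw [e₁ i hi.le, e₂ i hi.le, h₁.lower i hi, h₂.lower i hi]
  · rw [e₁ n le_rfl, e₂ n le_rfl, ← h₁.top, ← h₂.top]
    abel

theorem sum {ι : Type*} {S : Finset ι} {f g : ι → ℝ → E} {c : ι → E}
    (h : ∀ i ∈ S, JetDiff p n (f i) (g i) (c i)) :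
    JetDiff p n (fun s => ∑ i ∈ S, f i s) (fun s => ∑ i ∈ S, g i s) (∑ i ∈ S, c i) := by
  classical
  induction S using Finset.induction_on with
  | empty => simpa using refl contDiff_const
  | insert i S hi ih =>
    simp only [Finset.sum_insert hi]
    exact (h i (by simp)).add (ih fun j hj => h j (by simp [hj]))

/-- Product rule for jet differences. Only the lowest-order terms contribute, because each
derivative that falls on one factor lowers the order at which the other factors can differ. -/
theorem bilin (B : E →L[ℝ] F →L[ℝ] G) {f₁ g₁ : ℝ → E} {f₂ g₂ : ℝ → F} {c₁ : E} {c₂ : F}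
    (h₁ : JetDiff p n f₁ g₁ c₁) (h₂ : JetDiff p n f₂ g₂ c₂) :
    JetDiff p n (fun s => B (f₁ s) (f₂ s)) (fun s => B (g₁ s) (g₂ s))
      (B c₁ (f₂ p) + B (g₁ p) c₂) := by
  induction n generalizing f₁ g₁ f₂ g₂ c₁ c₂ with
  | zero =>
    rw [jetDiff_zero_iff] at *
    obtain ⟨a₁, b₁, rfl⟩ := h₁
    obtain ⟨a₂, b₂, rfl⟩ := h₂
    exact ⟨by fun_prop, by fun_prop, by simp⟩
  | succ n ih =>
    obtain ⟨hf₁, hg₁, e₁, h₁'⟩ := jetDiff_succ_iff.1 h₁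
    obtain ⟨hf₂, hg₂, e₂, h₂'⟩ := jetDiff_succ_iff.1 h₂
    have d {u : ℝ → E} {v : ℝ → F} (hu : Differentiable ℝ u) (hv : Differentiable ℝ v) (s : ℝ) :
        HasDerivAt (fun s => B (u s) (v s))
          (B (u s) (_root_.deriv v s) + B (_root_.deriv u s) (v s)) s :=
      B.hasDerivAt_of_bilinear (fun _ => (hu s).hasDerivAt) (fun _ => (hv s).hasDerivAt)
    refine jetDiff_succ_iff.2 ⟨fun s => (d hf₁ hf₂ s).differentiableAt,
      fun s => (d hg₁ hg₂ s).differentiableAt, by rw [e₁, e₂], ?_⟩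
    rw [funext fun s => (d hf₁ hf₂ s).deriv, funext fun s => (d hg₁ hg₂ s).deriv]
    have := (ih (h₁.of_lt n.lt_succ_self) h₂').add (ih h₁' (h₂.of_lt n.lt_succ_self))
    simpa [add_comm] using this

end JetDiff

end Jets

/-! ### Algebra of the cross product -/

/-- The cross product as a continuous bilinear map. -/
def crossL : E3 →L[ℝ] E3 →L[ℝ] E3 :=
  LinearMap.toContinuousBilinearMap <|
    LinearMap.mk₂ ℝ cross
      (fun x y z => by simp [cross])
      (fun r x y => by simp [cross])
      (fun x y z => by simp [cross])
      (fun r x y => by simp [cross])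

@[simp] theorem crossL_apply (x y : E3) : crossL x y = cross x y := rfl

theorem cross_zero (x : E3) : cross x 0 = 0 := (crossL x).map_zero

theorem cross_zero_left (x : E3) : cross 0 x = 0 := by
  rw [← crossL_apply]; simp

theorem inner_eq_coords (x y : E3) : inner ℝ x y = x 0 * y 0 + x 1 * y 1 + x 2 * y 2 := by
  simp [PiLp.inner_apply, Fin.sum_univ_three, mul_comm]

theorem inner_cross_self_left (a x : E3) : inner ℝ a (cross a x) = 0 := by
  simp [inner_eq_coords, cross, cross_apply]
  ring

theorem eq_zero_of_cross_eq_zero {a x : E3} (ha : ‖a‖ = 1) (h : cross a x = 0)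
    (hi : inner ℝ a x = 0) : x = 0 := by
  have ha' : inner ℝ a a = 1 := by rw [real_inner_self_eq_norm_sq, ha]; norm_num
  have h0 := congrArg (fun z : E3 => z 0) h
  have h1 := congrArg (fun z : E3 => z 1) h
  have h2 := congrArg (fun z : E3 => z 2) h
  rw [inner_eq_coords] at ha' hi
  simp [cross, cross_apply] at h0 h1 h2
  ext i
  fin_cases i <;> simp
  · linear_combination (-x 0) * ha' + a 0 * hi + a 2 * h1 - a 1 * h2
  · linear_combination (-x 1) * ha' + a 1 * hi + a 0 * h2 - a 2 * h0
  · linear_combination (-x 2) * ha' + a 2 * hi + a 1 * h0 - a 0 * h1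

/-- On vectors orthogonal to the unit vector `a`, the map `a × ·` is injective. -/
theorem eq_zero_of_iterate_cross_eq_zero {a x : E3} (ha : ‖a‖ = 1) (hi : inner ℝ a x = 0) (k : ℕ)
    (h : (cross a)^[k] x = 0) : x = 0 := by
  induction k generalizing x with
  | zero => simpa using h
  | succ k ih => exact eq_zero_of_cross_eq_zero ha (ih (inner_cross_self_left a x) h) hi

/-- The rotation by the angle `π` about the line `ℝ a`, i.e. the reflection in that line. -/
abbrev halfTurn (a : E3) : E3 ≃ₗᵢ[ℝ] E3 := (Submodule.span ℝ {a}).reflection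

theorem halfTurn_apply {a : E3} (ha : ‖a‖ = 1) (x : E3) :
    halfTurn a x = (2 * inner ℝ a x) • a - x := by
  rw [halfTurn, Submodule.reflection_singleton_apply, ha]
  simp [two_smul, add_smul, two_mul]

theorem halfTurn_self {a : E3} (ha : ‖a‖ = 1) : halfTurn a a = a := by
  rw [halfTurn_apply ha, real_inner_self_eq_norm_sq, ha]
  norm_num [two_smul]

/-- The half turn preserves orientation. -/
theorem cross_halfTurn {a : E3} (ha : ‖a‖ = 1) (x y : E3) :
    cross (halfTurn a x) (halfTurn a y) = halfTurn a (cross x y) := by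
  have ha' : inner ℝ a a = 1 := by rw [real_inner_self_eq_norm_sq, ha]; norm_num
  simp only [halfTurn_apply ha]
  simp only [inner_eq_coords] at *
  ext i
  fin_cases i <;> simp [cross, cross_apply]
  · linear_combination (-2 * (x 1 * y 2 - x 2 * y 1)) * ha'
  · linear_combination (-2 * (x 2 * y 0 - x 0 * y 2)) * ha'
  · linear_combination (-2 * (x 0 * y 1 - x 1 * y 0)) * ha'

/-! ### The formal time derivatives in terms of classical derivatives -/

/-- The expressions `Q_m(v)` with classical instead of distributional derivatives. -/
def classicalQ (ε : ℝ) (v : ℝ → E3) : ℕ → ℝ → E3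
  | 0 => v
  | m + 1 => fun s =>
      ∑ j : Fin (m + 1),
        (m.choose j : ℝ) • cross (classicalQ ε v j s) (deriv (deriv (classicalQ ε v (m - j))) s)
      + ε • deriv (deriv (classicalQ ε v m)) s
      + ε • ∑ j : Fin (m + 1), ∑ k : Fin (m - j + 1),
          ((m.choose j : ℝ) * ((m - j).choose k : ℝ) *
            inner ℝ (deriv (classicalQ ε v j) s) (deriv (classicalQ ε v k) s)) •
              classicalQ ε v (m - j - k) s

/-- If `V` and `W` agree at `p` to the order `2k - 1` and their derivatives of order `2k` differ by
`c`, then the derivatives of order `2k - 2j` of their `j`-th formal time derivatives differ by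
`(W(p) × · + ε)ʲ c`: only the top order part of `Q_j` sees the difference. -/
theorem jetDiff_classicalQ {p : ℝ} {k : ℕ} {V W : ℝ → E3} {c : E3} (ε : ℝ)
    (h : JetDiff p (2 * k) V W c) (j : ℕ) (hj : j ≤ k) :
    JetDiff p (2 * k - 2 * j) (classicalQ ε V j) (classicalQ ε W j)
      ((fun x => cross (W p) x + ε • x)^[j] c) := by
  induction j using Nat.strong_induction_on with
  | _ j ih =>
    cases j with
    | zero => simpa [classicalQ] using h
    | succ j =>
      set A : E3 → E3 := fun x => cross (W p) x + ε • x
      set n := 2 * k - 2 * (j + 1) with hn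
      have hlow (i : ℕ) (hi : i ≤ j) :
          JetDiff p n (classicalQ ε V i) (classicalQ ε W i) 0 :=
        (ih i (by omega) (by omega)).of_lt (by omega)
      have hlow₁ (i : ℕ) (hi : i ≤ j) :
          JetDiff p n (deriv (classicalQ ε V i))
            (deriv (classicalQ ε W i)) 0 :=
        ((ih i (by omega) (by omega)).of_lt (k := n + 1) (by omega)).deriv
      have htop : JetDiff p n (deriv (deriv (classicalQ ε V j)))
          (deriv (deriv (classicalQ ε W j))) (A^[j] c) := by
        have := ih j (by omega) (by omega)
        rw [show 2 * k - 2 * j = n + 1 + 1 by omega] at this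
        exact this.deriv.deriv
      have hlow₂ (i : ℕ) (hi : i < j) :
          JetDiff p n (deriv (deriv (classicalQ ε V i)))
            (deriv (deriv (classicalQ ε W i))) 0 :=
        ((ih i (by omega) (by omega)).of_lt (k := n + 1 + 1) (by omega)).deriv.deriv
      have hsmul {f g : ℝ → E3} {d : E3} (r : ℝ) (hd : JetDiff p n f g d) :
          JetDiff p n (fun s => r • f s) (fun s => r • g s) (r • d) := by
        simpa using (JetDiff.refl (p := p) (n := n) (f := fun _ => r) contDiff_const).bilin
          (ContinuousLinearMap.lsmul ℝ ℝ) hd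
      have hcross : JetDiff p n
          (fun s => ∑ i : Fin (j + 1), (j.choose i : ℝ) • cross (classicalQ ε V i s)
            (deriv (deriv (classicalQ ε V (j - i))) s))
          (fun s => ∑ i : Fin (j + 1), (j.choose i : ℝ) • cross (classicalQ ε W i s)
            (deriv (deriv (classicalQ ε W (j - i))) s))
          (cross (W p) (A^[j] c)) := by
        have key (i : Fin (j + 1)) : JetDiff p n
            (fun s => (j.choose i : ℝ) • cross (classicalQ ε V i s)
              (deriv (deriv (classicalQ ε V (j - i))) s))
            (fun s => (j.choose i : ℝ) • cross (classicalQ ε W i s)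
              (deriv (deriv (classicalQ ε W (j - i))) s))
            (if i = 0 then cross (W p) (A^[j] c) else 0) := by
          by_cases hi : i = 0
          · subst hi
            simpa [classicalQ, cross_zero_left] using hsmul (j.choose (0 : ℕ) : ℝ)
              ((hlow 0 (by omega)).bilin crossL htop)
          · have hi' : (i : ℕ) ≠ 0 := fun h => hi (Fin.ext h)
            simpa [hi, cross_zero_left, cross_zero] using hsmul (j.choose i : ℝ)
              ((hlow i (by omega)).bilin crossL (hlow₂ (j - i) (by omega)))
        simpa using JetDiff.sum (S := Finset.univ) fun i _ => key i
      have hcubic := JetDiff.sum (S := Finset.univ) (fun (i : Fin (j + 1)) _ =>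
        JetDiff.sum (S := Finset.univ) (fun (l : Fin (j - i + 1)) _ =>
          (((hlow₁ i (by omega)).bilin (innerSL ℝ) (hlow₁ l (by omega))).bilin
              (((j.choose i : ℝ) * ((j - i).choose l : ℝ)) • ContinuousLinearMap.lsmul ℝ ℝ)
            (hlow (j - i - l) (by omega)))))
      have := (hcross.add (hsmul ε htop)).add (hsmul ε hcubic)
      simp only [smul_apply, ContinuousLinearMap.lsmul_apply, map_zero,
        zero_apply, add_zero, smul_zero, Finset.sum_const_zero,
        smul_smul] at this
      simp only [classicalQ, Function.iterate_succ_apply']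
      exact this

theorem contDiff_classicalQ {k : ℕ} {V : ℝ → E3} (ε : ℝ) (hV : ContDiff ℝ (2 * k : ℕ) V) (j : ℕ)
    (hj : j ≤ k) : ContDiff ℝ (2 * k - 2 * j : ℕ) (classicalQ ε V j) :=
  (jetDiff_classicalQ ε (JetDiff.refl (p := 0) hV) j hj).left

theorem deriv_halfTurn_comp_sub (a : E3) (p : ℝ) (f : ℝ → E3) (s : ℝ) :
    deriv (fun s => halfTurn a (f (p - s))) s = -halfTurn a (deriv f (p - s)) := by
  have h₁ (g : ℝ → E3) : deriv (fun s => halfTurn a (g s)) s = halfTurn a (deriv g s) := by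
    have := (halfTurn a).comp_fderiv (f := g) (x := s)
    have h₂ := congrArg (fun L : ℝ →L[ℝ] E3 => L 1) this
    simpa [Function.comp_def] using h₂
  rw [h₁ (fun s => f (p - s)), deriv_comp_const_sub, map_neg]

/-- The expressions `Q_j` are equivariant under the half turn about `a` combined with the
reflection `s ↦ p - s` of the parameter, since they involve an even number of derivatives. -/
theorem classicalQ_halfTurn {a : E3} (ha : ‖a‖ = 1) (ε p : ℝ) (V : ℝ → E3) (j : ℕ) :
    classicalQ ε (fun s => halfTurn a (V (p - s))) j =
      fun s => halfTurn a (classicalQ ε V j (p - s)) := by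
  induction j using Nat.strong_induction_on with
  | _ j ih =>
    cases j with
    | zero => simp [classicalQ]
    | succ j =>
      have h₁ (i : ℕ) (hi : i < j + 1) :
          deriv (classicalQ ε (fun s => halfTurn a (V (p - s))) i) =
            fun s => halfTurn a (-deriv (classicalQ ε V i) (p - s)) := by
        rw [ih i hi]
        funext s
        rw [deriv_halfTurn_comp_sub, map_neg]
      have h₂ (i : ℕ) (hi : i < j + 1) :
          deriv (deriv (classicalQ ε (fun s => halfTurn a (V (p - s))) i)) =
            fun s => halfTurn a (deriv (deriv (classicalQ ε V i)) (p - s)) := by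
        rw [h₁ i hi]
        funext s
        have := deriv_halfTurn_comp_sub a p (fun s => -deriv (classicalQ ε V i) s) s
        rw [this, deriv.fun_neg, map_neg, neg_neg]
      funext s
      simp only [classicalQ, map_add, map_sum, map_smul]
      congr 1
      · congr 1
        · refine Finset.sum_congr rfl fun i _ => ?_
          rw [ih i (by omega), h₂ (j - i) (by omega), cross_halfTurn ha]
        · rw [h₂ j (by omega)]
      · congr 1
        refine Finset.sum_congr rfl fun i _ => Finset.sum_congr rfl fun l _ => ?_
        rw [ih (j - i - l) (by omega), h₁ i (by omega), h₁ l (by omega),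
          LinearIsometryEquiv.inner_map_map, inner_neg_neg]

/-! ### Conservation of the length of the field -/

theorem hasDerivAt_coeff_mul {f g : ℝ → PowerSeries ℝ} {f' g' : PowerSeries ℝ} {s : ℝ} {n : ℕ}
    (hf : ∀ i ≤ n, HasDerivAt (fun t => PowerSeries.coeff i (f t)) (PowerSeries.coeff i f') s)
    (hg : ∀ i ≤ n, HasDerivAt (fun t => PowerSeries.coeff i (g t)) (PowerSeries.coeff i g') s) :
    HasDerivAt (fun t => PowerSeries.coeff n (f t * g t))
      (PowerSeries.coeff n (f' * g s + f s * g')) s := by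
  simp only [PowerSeries.coeff_mul, map_add, ← Finset.sum_add_distrib]
  refine HasDerivAt.fun_sum fun ij hij => ?_
  have := Finset.HasAntidiagonal.mem_antidiagonal.1 hij
  exact (hf ij.1 (by omega)).mul (hg ij.2 (by omega))

/-- The Taylor series `∑ⱼ uⱼ tʲ / j!` of a coordinate of a curve whose time derivatives are `uⱼ`. -/
def timeSeries (u : ℕ → E3) (c : Fin 3) : PowerSeries ℝ :=
  PowerSeries.mk fun j => u j c / (j.factorial : ℝ)

/-- The sequences `u j = Q_j(s)`, `u₁ j = ∂ₛ Q_j(s)`, `u₂ j = ∂ₛ² Q_j(s)` are the time derivatives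
of a formal solution of `u_t = u × u₂ + ε u₂ + ε |u₁|² u`; here is the scalar product of this
equation with `u`. -/
theorem derivative_timeSeries_dot (ε : ℝ) (V : ℝ → E3) (s : ℝ) :
    letI A := timeSeries fun j => classicalQ ε V j s
    letI B := timeSeries fun j => deriv (classicalQ ε V j) s
    letI C := timeSeries fun j => deriv (deriv (classicalQ ε V j)) s
    PowerSeries.derivative ℝ (∑ c, A c * A c) =
      PowerSeries.C (2 * ε) * (∑ c, A c * C c + (∑ c, B c * B c) * ∑ c, A c * A c) := by
  set A := timeSeries fun j => classicalQ ε V j s with hA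
  set B := timeSeries fun j => deriv (classicalQ ε V j) s with hB
  set C := timeSeries fun j => deriv (deriv (classicalQ ε V j)) s with hC
  have hfac (j i : ℕ) (hi : i ≤ j) : (j.choose i : ℝ) / j.factorial =
      1 / (i.factorial * (j - i).factorial) := by
    rw [Nat.cast_choose ℝ hi]
    field_simp
  -- the formal evolution equation, coordinate by coordinate
  have key (c : Fin 3) (X : PowerSeries ℝ)
      (hX : ∀ j, PowerSeries.coeff j X = ∑ i ∈ Finset.range (j + 1),
        (cross (classicalQ ε V i s) (deriv (deriv (classicalQ ε V (j - i))) s)) c /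
          (i.factorial * (j - i).factorial)) :
      PowerSeries.derivative ℝ (A c) = X + PowerSeries.C ε * C c +
        PowerSeries.C ε * ∑ d, B d * (B d * A c) := by
    ext j
    have e₁ : PowerSeries.coeff j (PowerSeries.derivative ℝ (A c)) =
        classicalQ ε V (j + 1) s c / j.factorial := by
      simp only [PowerSeries.coeff_derivative, hA, timeSeries, PowerSeries.coeff_mk,
        Nat.factorial_succ]
      push_cast
      field_simp
    have e₂ : PowerSeries.coeff j (∑ d, B d * (B d * A c)) =
        ∑ i ∈ Finset.range (j + 1), ∑ k ∈ Finset.range (j - i + 1),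
          (inner ℝ (deriv (classicalQ ε V i) s) (deriv (classicalQ ε V k) s) *
            classicalQ ε V (j - i - k) s c) /
            (i.factorial * (k.factorial * (j - i - k).factorial)) := by
      simp only [map_sum, PowerSeries.coeff_mul,
        Finset.Nat.sum_antidiagonal_eq_sum_range_succ_mk, Nat.succ_eq_add_one, hA, hB, timeSeries,
        PowerSeries.coeff_mk, Finset.mul_sum]
      rw [Finset.sum_comm]
      refine Finset.sum_congr rfl fun i _ => ?_
      rw [Finset.sum_comm]
      refine Finset.sum_congr rfl fun k _ => ?_
      rw [inner_eq_coords, Fin.sum_univ_three]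
      field_simp
    have e₃ : PowerSeries.coeff j (C c) = deriv (deriv (classicalQ ε V j)) s c / j.factorial := by
      simp [hC, timeSeries]
    simp only [map_add, PowerSeries.coeff_C_mul]
    rw [e₁, e₂, e₃, hX, classicalQ]
    simp only [PiLp.add_apply, PiLp.smul_apply, WithLp.ofLp_sum, Finset.sum_apply, smul_eq_mul,
      add_div]
    congr 1
    · congr 1
      · rw [Finset.sum_range, Finset.sum_div]
        refine Finset.sum_congr rfl fun i _ => ?_
        rw [mul_div_right_comm, hfac j i (by omega)]
        ring
      · ring
    · rw [mul_div_assoc, Finset.sum_range, Finset.sum_div]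
      congr 1
      refine Finset.sum_congr rfl fun i _ => ?_
      rw [Finset.sum_range, Finset.sum_div]
      refine Finset.sum_congr rfl fun k _ => ?_
      have h₁ := hfac j i (by omega)
      have h₂ : ((j - i).choose k : ℝ) = (j - i : ℕ).factorial *
          (1 / ((k : ℕ).factorial * (j - i - k).factorial)) := by
        rw [← hfac (j - i) k (by omega)]
        field_simp
      rw [mul_assoc, mul_assoc, mul_div_right_comm, h₁, h₂]
      field_simp
  have hcr (p q r : Fin 3)
      (h : ∀ x y : E3, cross x y p = x q * y r - x r * y q) (j : ℕ) :
      PowerSeries.coeff j (A q * C r - A r * C q) = ∑ i ∈ Finset.range (j + 1),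
        (cross (classicalQ ε V i s) (deriv (deriv (classicalQ ε V (j - i))) s)) p /
          (i.factorial * (j - i).factorial) := by
    simp only [map_sub, PowerSeries.coeff_mul, Finset.Nat.sum_antidiagonal_eq_sum_range_succ_mk,
      ← Finset.sum_sub_distrib, Nat.succ_eq_add_one, hA, hC, timeSeries, PowerSeries.coeff_mk]
    refine Finset.sum_congr rfl fun i _ => ?_
    rw [h]
    field_simp
  have k₀ := key 0 _ (hcr 0 1 2 fun x y => by simp [cross, cross_apply])
  have k₁ := key 1 _ (hcr 1 2 0 fun x y => by simp [cross, cross_apply])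
  have k₂ := key 2 _ (hcr 2 0 1 fun x y => by simp [cross, cross_apply])
  simp only [Fin.sum_univ_three] at *
  simp only [map_add, Derivation.leibniz, smul_eq_mul, k₀, k₁, k₂, map_mul]
  have : (PowerSeries.C (2 : ℝ)) = 2 := map_ofNat _ 2
  rw [this]
  ring

theorem coeff_timeSeries_dot (u : ℕ → E3) (k : ℕ) :
    PowerSeries.coeff k (∑ c, timeSeries u c * timeSeries u c) =
      ∑ ij ∈ Finset.HasAntidiagonal.antidiagonal k, inner ℝ (u ij.1) (u ij.2) /
        (ij.1.factorial * ij.2.factorial : ℝ) := by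
  simp only [map_sum, PowerSeries.coeff_mul]
  rw [Finset.sum_comm]
  refine Finset.sum_congr rfl fun ij _ => ?_
  simp only [timeSeries, PowerSeries.coeff_mk, inner_eq_coords, Fin.sum_univ_three]
  field_simp

/-- If `|V| = 1` on `(0,1)`, then the formal time derivatives of `|V|²` vanish there. They satisfy
the linear equation `N_t = ε (N_ss + 2 |V_s|² (N - 1))`, which has the solution `N = 1`. -/
theorem coeff_timeSeries_dot_eq_zero {m : ℕ} {V : ℝ → E3} (ε : ℝ)
    (hV : ContDiff ℝ (2 * m : ℕ) V) (hunit : ∀ s ∈ Ioo (0 : ℝ) 1, ‖V s‖ = 1) (k : ℕ) (hk : 1 ≤ k)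
    (hkm : k ≤ m) (s : ℝ) (hs : s ∈ Ioo (0 : ℝ) 1) :
    PowerSeries.coeff k (∑ c, timeSeries (fun j => classicalQ ε V j s) c *
      timeSeries (fun j => classicalQ ε V j s) c) = 0 := by
  induction k using Nat.strong_induction_on generalizing s with
  | _ k ih =>
    obtain ⟨k, rfl⟩ : ∃ k', k = k' + 1 := ⟨k - 1, by omega⟩
    set A : ℝ → Fin 3 → PowerSeries ℝ := fun s => timeSeries fun j => classicalQ ε V j s with hA
    set B : ℝ → Fin 3 → PowerSeries ℝ :=
      fun s => timeSeries fun j => deriv (classicalQ ε V j) s with hB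
    set C : ℝ → Fin 3 → PowerSeries ℝ :=
      fun s => timeSeries fun j => deriv (deriv (classicalQ ε V j)) s with hC
    have hN (i : ℕ) (hi : i ≤ k) (t : ℝ) (ht : t ∈ Ioo (0 : ℝ) 1) :
        PowerSeries.coeff i (∑ c, A t c * A t c) = if i = 0 then 1 else 0 := by
      rcases Nat.eq_zero_or_pos i with rfl | hi0
      · rw [hA, coeff_timeSeries_dot]
        simp [classicalQ, hunit t ht]
      · rw [if_neg hi0.ne']
        exact ih i (by omega) hi0 (by omega) t ht
    have hsmooth (i : ℕ) (hi : i ≤ k) : Differentiable ℝ (classicalQ ε V i) ∧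
        Differentiable ℝ (deriv (classicalQ ε V i)) := by
      have h := contDiff_classicalQ ε hV i (by omega)
      have h2 : ContDiff ℝ ((0 + 1 + 1 : ℕ) : ℕ∞ω) (classicalQ ε V i) :=
        h.of_le (by exact_mod_cast (by omega : 0 + 1 + 1 ≤ 2 * m - 2 * i))
      obtain ⟨h3, h4⟩ := contDiff_natSucc_iff.1 h2
      exact ⟨h3, (contDiff_natSucc_iff.1 h4).1⟩
    have hcoord {u : ℝ → E3} (hu : Differentiable ℝ u) (t : ℝ) (c : Fin 3) :
        HasDerivAt (fun t => u t c) (deriv u t c) t :=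
      (EuclideanSpace.proj (𝕜 := ℝ) c).hasFDerivAt.comp_hasDerivAt t (hu t).hasDerivAt
    have hdA (i : ℕ) (hi : i ≤ k) (c : Fin 3) (t : ℝ) :
        HasDerivAt (fun t => PowerSeries.coeff i (A t c)) (PowerSeries.coeff i (B t c)) t := by
      simp only [hA, hB, timeSeries, PowerSeries.coeff_mk]
      exact (hcoord (hsmooth i hi).1 t c).div_const _
    have hdB (i : ℕ) (hi : i ≤ k) (c : Fin 3) (t : ℝ) :
        HasDerivAt (fun t => PowerSeries.coeff i (B t c)) (PowerSeries.coeff i (C t c)) t := by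
      simp only [hC, hB, timeSeries, PowerSeries.coeff_mk]
      exact (hcoord (hsmooth i hi).2 t c).div_const _
    have hU (t : ℝ) (ht : t ∈ Ioo (0 : ℝ) 1) : ∀ᶠ r in 𝓝 t, r ∈ Ioo (0 : ℝ) 1 :=
      isOpen_Ioo.mem_nhds ht
    -- differentiating the constant `|V|²` twice in space
    have h₁ (t : ℝ) (ht : t ∈ Ioo (0 : ℝ) 1) :
        ∑ c, PowerSeries.coeff k (A t c * B t c) = 0 := by
      have d : HasDerivAt (fun t => ∑ c, PowerSeries.coeff k (A t c * A t c))
          (∑ c, PowerSeries.coeff k (B t c * A t c + A t c * B t c)) t :=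
        HasDerivAt.fun_sum fun c _ =>
          hasDerivAt_coeff_mul (fun i hi => hdA i hi c t) (fun i hi => hdA i hi c t)
      have e : (fun t => ∑ c, PowerSeries.coeff k (A t c * A t c)) =ᶠ[𝓝 t]
          fun _ => if k = 0 then 1 else 0 := by
        filter_upwards [hU t ht] with r hr
        rw [← hN k le_rfl r hr, map_sum]
      have := d.unique ((hasDerivAt_const t _).congr_of_eventuallyEq e)
      simp only [mul_comm (B t _), map_add, Finset.sum_add_distrib] at this
      linarith
    have h₂ : ∑ c, PowerSeries.coeff k (B s c * B s c + A s c * C s c) = 0 := by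
      have d : HasDerivAt (fun t => ∑ c, PowerSeries.coeff k (A t c * B t c))
          (∑ c, PowerSeries.coeff k (B s c * B s c + A s c * C s c)) s :=
        HasDerivAt.fun_sum fun c _ =>
          hasDerivAt_coeff_mul (fun i hi => hdA i hi c s) (fun i hi => hdB i hi c s)
      have e : (fun t => ∑ c, PowerSeries.coeff k (A t c * B t c)) =ᶠ[𝓝 s] fun _ => 0 := by
        filter_upwards [hU s hs] with r hr using h₁ r hr
      exact d.unique ((hasDerivAt_const s _).congr_of_eventuallyEq e)
    have h₃ : PowerSeries.coeff k ((∑ c, B s c * B s c) * ∑ c, A s c * A s c) =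
        PowerSeries.coeff k (∑ c, B s c * B s c) := by
      rw [PowerSeries.coeff_mul, Finset.sum_eq_single (k, 0)]
      · simp [hN 0 (by omega) s hs]
      · intro ij hij hne
        have hsum := Finset.HasAntidiagonal.mem_antidiagonal.1 hij
        have : ij.2 ≠ 0 := fun h0 => hne (Prod.ext (by simp; omega) h0)
        rw [hN ij.2 (by omega) s hs, if_neg this, mul_zero]
      · simp
    have h₄ := congrArg (PowerSeries.coeff k) (derivative_timeSeries_dot ε V s)
    simp only [PowerSeries.coeff_derivative, PowerSeries.coeff_C_mul, map_add] at h₄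
    have h₅ : PowerSeries.coeff k (∑ c, A s c * C s c) +
        PowerSeries.coeff k ((∑ c, B s c * B s c) * ∑ c, A s c * A s c) = 0 := by
      rw [h₃, ← h₂, map_sum, map_sum, ← Finset.sum_add_distrib]
      exact Finset.sum_congr rfl fun c _ => by rw [map_add, add_comm]
    rw [h₅, mul_zero] at h₄
    exact (mul_eq_zero.1 h₄).resolve_right (by positivity)

/-! ### The compatibility conditions at an end point -/

theorem eq_of_continuous_of_eqOn_Ioo {g : ℝ → ℝ} {K p : ℝ} (hg : Continuous g)
    (h : ∀ s ∈ Ioo (0 : ℝ) 1, g s = K) (hp : p ∈ Icc (0 : ℝ) 1) : g p = K := by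
  rw [← closure_Ioo (zero_ne_one' ℝ)] at hp
  exact closure_minimal (s := Ioo (0 : ℝ) 1) (t := {s | g s = K}) h
    (isClosed_eq hg continuous_const) hp

theorem iteratedDeriv_eq_zero_of_eqOn_Ioo {g : ℝ → ℝ} {K p : ℝ} {i : ℕ} (hg : ContDiff ℝ i g)
    (hi : i ≠ 0) (h : ∀ s ∈ Ioo (0 : ℝ) 1, g s = K) (hp : p ∈ Icc (0 : ℝ) 1) :
    iteratedDeriv i g p = 0 := by
  refine eq_of_continuous_of_eqOn_Ioo (hg.continuous_iteratedDeriv i le_rfl) (fun s hs => ?_) hp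
  have : g =ᶠ[𝓝 s] fun _ => K := by
    filter_upwards [isOpen_Ioo.mem_nhds hs] with r hr using h r hr
  rw [this.iteratedDeriv_eq, iteratedDeriv_const, if_neg hi]

theorem iteratedDeriv_halfTurn_comp_sub (a : E3) (p : ℝ) (V : ℝ → E3) (i : ℕ) (s : ℝ) :
    iteratedDeriv i (fun s => halfTurn a (V (p - s))) s =
      (-1 : ℝ) ^ i • halfTurn a (iteratedDeriv i V (p - s)) := by
  induction i generalizing s with
  | zero => simp
  | succ i ih =>
    rw [iteratedDeriv_succ, funext ih, deriv_fun_const_smul_field, deriv_halfTurn_comp_sub,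
      iteratedDeriv_succ, pow_succ]
    simp

/-- The compatibility conditions of the limiting problem at `p` make the jet of `V` at `p`
invariant under the half turn about `a = V(p)` combined with the reflection of the parameter. The
condition of order `k` takes care of the component of the `2k`-th derivative orthogonal to `a`; the
component of the odd derivatives along `a` vanishes because `|V| = 1`. -/
theorem jetDiff_halfTurn {m : ℕ} {V : ℝ → E3} {a : E3} {p : ℝ} (ha : ‖a‖ = 1)
    (hp : p ∈ Icc (0 : ℝ) 1) (hV : ContDiff ℝ (2 * m : ℕ) V)
    (hunit : ∀ s ∈ Ioo (0 : ℝ) 1, ‖V s‖ = 1) (hVp : V p = a)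
    (h0 : ∀ k, 1 ≤ k → k ≤ m → classicalQ 0 V k p = 0) (i : ℕ) (hi : i ≤ 2 * m) :
    JetDiff p i V (fun s => halfTurn a (V (2 * p - s))) 0 := by
  have hpp : 2 * p - p = p := by ring
  induction i with
  | zero =>
    have hc := hV.continuous
    refine jetDiff_zero_iff.2 ⟨hc, (halfTurn a).continuous.comp (by fun_prop), ?_⟩
    simp only [hpp, hVp]
    rw [halfTurn_self ha, sub_self]
  | succ i ih =>
    have ih := ih (by omega)
    have hVi : ContDiff ℝ (i + 1 : ℕ) V := hV.of_le (by exact_mod_cast hi)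
    set W : ℝ → E3 := fun s => halfTurn a (V (2 * p - s)) with hW
    have hWi : ContDiff ℝ (i + 1 : ℕ) W :=
      (halfTurn a).contDiff.comp (hVi.comp (contDiff_const.sub contDiff_id))
    set c := iteratedDeriv (i + 1) V p - iteratedDeriv (i + 1) W p with hc
    have hJ : JetDiff p (i + 1) V W c := by
      refine ⟨hVi, hWi, fun j hj => ?_, rfl⟩
      rcases (Nat.lt_succ_iff.1 hj).lt_or_eq with hj | rfl
      · exact ih.lower j hj
      · exact sub_eq_zero.1 ih.top
    suffices c = 0 by rwa [this] at hJ
    have hWp : W p = a := by rw [← ih.apply_eq, hVp]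
    -- `|V|² = 1` excludes a component along `a`
    have hca : inner ℝ a c = 0 := by
      have hN := (hJ.bilin (innerSL ℝ) hJ).top
      have hNV : ContDiff ℝ (i + 1 : ℕ) fun s => inner ℝ (V s) (V s) := hVi.inner ℝ hVi
      have e₁ : iteratedDeriv (i + 1) (fun s => inner ℝ (V s) (V s)) p = 0 := by
        refine iteratedDeriv_eq_zero_of_eqOn_Ioo (K := 1) hNV (by omega) (fun s hs => ?_) hp
        rw [real_inner_self_eq_norm_sq, hunit s hs, one_pow]
      have e₂ : iteratedDeriv (i + 1) (fun s => inner ℝ (W s) (W s)) p = 0 := by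
        simp only [hW, LinearIsometryEquiv.inner_map_map]
        rw [iteratedDeriv_comp_const_sub (f := fun s => inner ℝ (V s) (V s))]
        simp only [hpp, e₁, smul_zero]
      change iteratedDeriv (i + 1) (fun s => inner ℝ (V s) (V s)) p -
        iteratedDeriv (i + 1) (fun s => inner ℝ (W s) (W s)) p = inner ℝ c (V p) + inner ℝ (W p) c
        at hN
      rw [e₁, e₂, hWp, hVp, real_inner_comm] at hN
      linarith
    have hc' : c = iteratedDeriv (i + 1) V p -
        (-1 : ℝ) ^ (i + 1) • halfTurn a (iteratedDeriv (i + 1) V p) := by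
      rw [hc, hW, iteratedDeriv_halfTurn_comp_sub, hpp]
    rcases Nat.even_or_odd' (i + 1) with ⟨k, hk | hk⟩
    · rw [hk] at hJ
      have hQ := jetDiff_classicalQ 0 hJ k le_rfl
      rw [Nat.sub_self, jetDiff_zero_iff, hW, classicalQ_halfTurn ha] at hQ
      have hQ := hQ.2.2
      simp only [hpp, h0 k (by omega) (by omega), map_zero, sub_zero, zero_smul, add_zero, hVp,
        halfTurn_self ha] at hQ
      exact eq_zero_of_iterate_cross_eq_zero ha hca k hQ.symm
    · have : c = (2 * inner ℝ a (iteratedDeriv (i + 1) V p)) • a := by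
        rw [hc', halfTurn_apply ha, hk, pow_succ, pow_mul]
        simp
      rw [this, inner_smul_right, real_inner_self_eq_norm_sq, ha] at hca
      rw [this]
      simp at hca
      simp [hca]

/-- At an end point, the compatibility conditions of the limiting problem imply those of the
regularized problem, for every `ε`. -/
theorem classicalQ_eq_zero {m : ℕ} {V : ℝ → E3} {a : E3} {p : ℝ} (ha : ‖a‖ = 1)
    (hp : p ∈ Icc (0 : ℝ) 1) (hV : ContDiff ℝ (2 * m : ℕ) V)
    (hunit : ∀ s ∈ Ioo (0 : ℝ) 1, ‖V s‖ = 1) (hVp : V p = a)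
    (h0 : ∀ k, 1 ≤ k → k ≤ m → classicalQ 0 V k p = 0) (ε : ℝ) (k : ℕ) (hk : 1 ≤ k) (hkm : k ≤ m) :
    classicalQ ε V k p = 0 := by
  induction k using Nat.strong_induction_on with
  | _ k ih =>
    have hpar : classicalQ ε V k p = halfTurn a (classicalQ ε V k p) := by
      have hJ := jetDiff_classicalQ ε (jetDiff_halfTurn ha hp hV hunit hVp h0 (2 * k) (by omega))
        k le_rfl
      have hit : (fun x => cross (halfTurn a (V (2 * p - p))) x + ε • x)^[k] 0 = 0 :=
        Function.iterate_fixed (by simp [cross_zero]) k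
      rw [hit] at hJ
      have := hJ.apply_eq
      simpa only [classicalQ_halfTurn ha, show 2 * p - p = p by ring] using this
    have hN : PowerSeries.coeff k (∑ c, timeSeries (fun j => classicalQ ε V j p) c *
        timeSeries (fun j => classicalQ ε V j p) c) = 0 := by
      refine eq_of_continuous_of_eqOn_Ioo (K := 0) (g := fun s => PowerSeries.coeff k
        (∑ c, timeSeries (fun j => classicalQ ε V j s) c *
          timeSeries (fun j => classicalQ ε V j s) c)) ?_
        (coeff_timeSeries_dot_eq_zero ε hV hunit k hk hkm) hp
      simp only [coeff_timeSeries_dot]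
      refine continuous_finsetSum _ fun ij hij => ?_
      have := Finset.HasAntidiagonal.mem_antidiagonal.1 hij
      have c₁ := (contDiff_classicalQ ε hV ij.1 (by omega)).continuous
      have c₂ := (contDiff_classicalQ ε hV ij.2 (by omega)).continuous
      fun_prop
    have hin : inner ℝ a (classicalQ ε V k p) = 0 := by
      rw [coeff_timeSeries_dot, Finset.sum_eq_add (0, k) (k, 0)] at hN
      · simp only [classicalQ, hVp, real_inner_comm] at hN
        have : (k.factorial : ℝ) ≠ 0 := by positivity
        simp only [Nat.factorial_zero, Nat.cast_one, one_mul, mul_one] at hN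
        rw [← two_mul] at hN
        simpa [this] using hN
      · simp; omega
      · rintro ⟨i, j⟩ hij ⟨h₁, h₂⟩
        have hsum : i + j = k := Finset.HasAntidiagonal.mem_antidiagonal.1 hij
        have hi : i ≠ 0 := by rintro rfl; simp at hsum; simp [hsum] at h₁
        have hj : j ≠ 0 := by rintro rfl; simp at hsum; simp [hsum] at h₂
        simp [ih i (by omega) (by omega) (by omega)]
      · simp
      · simp
    rw [hpar, halfTurn_apply ha, hin]
    rw [halfTurn_apply ha, hin] at hpar
    simp only [mul_zero, zero_smul, zero_sub] at *
    have h2 : (2 : ℝ) • classicalQ ε V k p = 0 := by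
      rw [two_smul]
      nth_rewrite 1 [hpar]
      exact neg_add_cancel _
    simpa using h2

/-! ### Distributional derivatives on the interval -/

namespace IsTestFunction

variable {φ ψ : ℝ → ℝ}

theorem deriv (h : IsTestFunction φ) : IsTestFunction (deriv φ) :=
  ⟨(contDiff_infty_iff_deriv.1 h.1).2, h.2.1.deriv, tsupport_deriv_subset.trans h.2.2⟩

theorem iteratedDeriv (h : IsTestFunction φ) (k : ℕ) : IsTestFunction (iteratedDeriv k φ) := by
  induction k with
  | zero => simpa using h
  | succ k ih => rw [iteratedDeriv_succ]; exact ih.deriv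

theorem eq_zero_of_notMem (h : IsTestFunction φ) {s : ℝ} (hs : s ∉ I) : φ s = 0 :=
  image_eq_zero_of_notMem_tsupport fun h' => hs (h.2.2 h')

theorem apply_zero (h : IsTestFunction φ) : φ 0 = 0 := h.eq_zero_of_notMem (by simp [I])

theorem apply_one (h : IsTestFunction φ) : φ 1 = 0 := h.eq_zero_of_notMem (by simp [I])

theorem integrableOn_smul (h : IsTestFunction φ) {u : ℝ → E3} (hu : LocallyIntegrableOn u I) :
    IntegrableOn (fun s => φ s • u s) I := by
  have h₁ : IntegrableOn (fun s => φ s • u s) (tsupport φ) :=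
    (hu.integrableOn_compact_subset h.2.2 h.2.1).continuousOn_smul
      h.1.continuous.continuousOn h.2.1
  refine ((integrableOn_iff_integrable_of_support_subset fun s hs => ?_).1 h₁).integrableOn
  exact subset_tsupport φ fun h0 => hs (by simp [h0])

theorem setIntegral_eq (h : IsTestFunction φ) : ∫ s in I, φ s = ∫ s, φ s :=
  setIntegral_eq_integral_of_forall_compl_eq_zero fun _ hs => h.eq_zero_of_notMem hs

theorem sub_const_mul (h : IsTestFunction φ) (hψ : IsTestFunction ψ) (r : ℝ) :
    IsTestFunction fun s => φ s - r * ψ s := by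
  refine ⟨h.1.sub (contDiff_const.mul hψ.1), h.2.1.sub hψ.2.1.mul_left, ?_⟩
  have : tsupport (fun s => φ s - r * ψ s) ⊆ tsupport φ ∪ tsupport ψ :=
    closure_minimal (fun s hs => by
      by_contra hn
      simp only [mem_union, not_or] at hn
      exact hs (by simp [image_eq_zero_of_notMem_tsupport hn.1,
        image_eq_zero_of_notMem_tsupport hn.2]))
      ((isClosed_tsupport φ).union (isClosed_tsupport ψ))
  exact this.trans (union_subset h.2.2 hψ.2.2)

/-- A test function of integral zero is the derivative of a test function. -/
theorem exists_primitive (h : IsTestFunction φ) (h0 : ∫ s, φ s = 0) :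
    ∃ Φ, IsTestFunction Φ ∧ _root_.deriv Φ = φ := by
  rcases (tsupport φ).eq_empty_or_nonempty with he | hne
  · have : φ = 0 := tsupport_eq_empty_iff.1 he
    refine ⟨0, ⟨contDiff_const, HasCompactSupport.zero, by simp⟩, ?_⟩
    rw [this]
    exact funext fun s => deriv_const s 0
  · obtain ⟨x, hx, hxl⟩ := h.2.1.isCompact.exists_isLeast hne
    obtain ⟨y, hy, hyl⟩ := h.2.1.isCompact.exists_isGreatest hne
    have hx0 := (h.2.2 hx).1
    have hy1 := (h.2.2 hy).2
    have hd (s : ℝ) : HasDerivAt (fun s => ∫ t in (0 : ℝ)..s, φ t) (φ s) s :=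
      intervalIntegral.integral_hasDerivAt_right (h.1.continuous.intervalIntegrable _ _)
        (h.1.continuous.stronglyMeasurableAtFilter _ _) h.1.continuous.continuousAt
    have hD : _root_.deriv (fun s => ∫ t in (0 : ℝ)..s, φ t) = φ := funext fun s => (hd s).deriv
    have hsupp : Function.support (fun s => ∫ t in (0 : ℝ)..s, φ t) ⊆ Icc x y := by
      intro s hs
      by_contra hn
      apply hs
      rcases lt_or_ge s x with hsx | hsx
      · refine intervalIntegral.integral_zero_ae (Eventually.of_forall fun t ht => ?_)
        refine image_eq_zero_of_notMem_tsupport fun ht' => ?_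
        have h₁ := hxl ht'
        have h₂ : t ≤ max 0 s := ht.2
        rcases le_max_iff.1 h₂ with h₂ | h₂ <;> linarith
      · have hys : y < s := by
          by_contra hc
          exact hn ⟨hsx, not_lt.1 hc⟩
        change ∫ t in (0 : ℝ)..s, φ t = 0
        rw [intervalIntegral.integral_eq_integral_of_support_subset, h0]
        intro t ht
        have ht' := subset_tsupport φ ht
        exact ⟨(h.2.2 ht').1, (hyl ht').trans hys.le⟩
    refine ⟨_, ⟨contDiff_infty_iff_deriv.2 ⟨fun s => (hd s).differentiableAt, ?_⟩,
      HasCompactSupport.of_support_subset_isCompact isCompact_Icc hsupp, ?_⟩, hD⟩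
    · rw [hD]
      exact h.1
    · exact (closure_minimal hsupp isClosed_Icc).trans fun t ht =>
        ⟨hx0.trans_le ht.1, ht.2.trans_lt hy1⟩

theorem exists_integral_eq_one : ∃ χ, IsTestFunction χ ∧ ∫ s, χ s = 1 := by
  let b : ContDiffBump (1 / 2 : ℝ) := ⟨1 / 8, 1 / 4, by norm_num, by norm_num⟩
  refine ⟨b.normed volume, ⟨b.contDiff_normed, b.hasCompactSupport_normed, ?_⟩, b.integral_normed⟩
  rw [b.tsupport_normed_eq, Real.closedBall_eq_Icc]
  intro s hs
  simp only [b, mem_Icc] at hs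
  constructor <;> linarith [hs.1, hs.2]

end IsTestFunction

theorem ae_eq_of_integral_smul_eq {f g : ℝ → E3} (hf : LocallyIntegrableOn f I)
    (hg : LocallyIntegrableOn g I)
    (h : ∀ φ, IsTestFunction φ → ∫ s in I, φ s • f s = ∫ s in I, φ s • g s) :
    f =ᵐ[volume.restrict I] g := by
  have := isOpen_Ioo.ae_eq_zero_of_integral_contDiff_smul_eq_zero (μ := volume) (hf.sub hg)
    fun φ h₁ h₂ h₃ => by
      have hφ : IsTestFunction φ := ⟨h₁, h₂, h₃⟩
      rw [← setIntegral_eq_integral_of_forall_compl_eq_zero (s := I)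
        fun s hs => by simp [hφ.eq_zero_of_notMem hs]]
      simp only [Pi.sub_apply, smul_sub]
      rw [integral_sub (hφ.integrableOn_smul hf) (hφ.integrableOn_smul hg), h φ hφ, sub_self]
  rw [EventuallyEq, ae_restrict_iff' (by exact measurableSet_Ioo)]
  filter_upwards [this] with s hs hsI
  exact sub_eq_zero.1 (hs hsI)

theorem IsWeakDeriv.ae_eq {k : ℕ} {u g g' : ℝ → E3} (h : IsWeakDeriv k u g)
    (h' : IsWeakDeriv k u g') : g =ᵐ[volume.restrict I] g' := by
  refine ae_eq_of_integral_smul_eq h.2.1 h'.2.1 fun φ hφ => ?_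
  have := (h.2.2 φ hφ).symm.trans (h'.2.2 φ hφ)
  exact smul_right_injective _ (pow_ne_zero k (by norm_num)) this

theorem IsWeakDeriv.congr_left {k : ℕ} {u v g : ℝ → E3} (h : IsWeakDeriv k u g)
    (huv : u =ᵐ[volume.restrict I] v) : IsWeakDeriv k v g := by
  refine ⟨h.1.congr huv, h.2.1, fun φ hφ => ?_⟩
  rw [← h.2.2 φ hφ]
  exact integral_congr_ae (huv.mono fun s hs => by simp only [hs])

theorem IsWeakDeriv.of_succ {k : ℕ} {u g w : ℝ → E3} (h : IsWeakDeriv 1 u g)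
    (h' : IsWeakDeriv (k + 1) u w) : IsWeakDeriv k g w := by
  refine ⟨h.2.1, h'.2.1, fun φ hφ => ?_⟩
  have h₁ := h.2.2 _ (hφ.iteratedDeriv k)
  have h₂ := h'.2.2 φ hφ
  rw [iteratedDeriv_one, ← iteratedDeriv_succ, h₂, pow_succ] at h₁
  simpa using h₁.symm

/-- Integration by parts against a primitive of a merely integrable function. -/
theorem integral_deriv_smul_primitive {φ : ℝ → ℝ} (hφ : IsTestFunction φ) {g : ℝ → E3}
    (hg : ∀ a b, IntervalIntegrable g volume a b) :
    ∫ s in I, deriv φ s • (∫ t in (0 : ℝ)..s, g t) = -∫ s in I, φ s • g s := by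
  have hI (f : ℝ → E3) : ∫ s in I, f s = ∫ s in (0 : ℝ)..1, f s := by
    rw [intervalIntegral.integral_of_le zero_le_one, integral_Ioc_eq_integral_Ioo, I]
  have hc : Continuous fun s => ∫ t in (0 : ℝ)..s, g t :=
    intervalIntegral.continuous_primitive hg 0
  have i₁ : IntervalIntegrable (fun s => deriv φ s • ∫ t in (0 : ℝ)..s, g t) volume 0 1 :=
    (hφ.deriv.1.continuous.smul hc).intervalIntegrable _ _
  have i₂ : IntervalIntegrable (fun s => φ s • g s) volume 0 1 :=
    (hg 0 1).continuousOn_smul hφ.1.continuous.continuousOn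
  rw [hI, hI]
  ext c
  let L : E3 →L[ℝ] ℝ := EuclideanSpace.proj c
  have hL : ∀ (a b : ℝ), IntervalIntegrable (fun t => L (g t)) volume a b := fun a b =>
    ⟨L.integrable_comp (hg a b).1, L.integrable_comp (hg a b).2⟩
  have hLc (x : E3) : x.ofLp c = L x := rfl
  rw [hLc, hLc, map_neg, ← L.intervalIntegral_comp_comm i₁, ← L.intervalIntegral_comp_comm i₂]
  simp only [map_smul, smul_eq_mul, ← L.intervalIntegral_comp_comm (hg _ _)]
  have hac := (hL 0 1).absolutelyContinuousOnInterval_intervalIntegral (c := 0) (by simp)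
  have hφac : AbsolutelyContinuousOnInterval φ 0 1 :=
    (hφ.1.of_le (n := ∞) (m := 1) (by simp)).contDiffOn.absolutelyContinuousOnInterval
  have key := hφac.integral_mul_deriv_eq_deriv_mul hac
  rw [hφ.apply_zero, hφ.apply_one, zero_mul, zero_mul, sub_zero, zero_sub] at key
  rw [← neg_eq_iff_eq_neg.2 key, neg_inj]
  refine intervalIntegral.integral_congr_ae ?_
  filter_upwards [(hL 0 1).ae_hasDerivAt_integral] with s hs hs'
  rw [(hs (uIoc_subset_uIcc hs') 0 (by simp)).deriv]

/-- A function whose first distributional derivative is integrable is a primitive of it. -/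
theorem IsWeakDeriv.ae_eq_primitive {u g : ℝ → E3} (h : IsWeakDeriv 1 u g)
    (hg : ∀ a b, IntervalIntegrable g volume a b) :
    ∃ c : E3, u =ᵐ[volume.restrict I] fun s => c + ∫ t in (0 : ℝ)..s, g t := by
  have hc : Continuous fun s => ∫ t in (0 : ℝ)..s, g t :=
    intervalIntegral.continuous_primitive hg 0
  have hcl := hc.locallyIntegrable.locallyIntegrableOn (μ := volume) I
  have hul : LocallyIntegrableOn (fun s => u s - ∫ t in (0 : ℝ)..s, g t) I := h.1.sub hcl
  obtain ⟨χ, hχ, hχ1⟩ := IsTestFunction.exists_integral_eq_one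
  set c := ∫ s in I, χ s • (u s - ∫ t in (0 : ℝ)..s, g t)
  have key : (fun s => u s - ∫ t in (0 : ℝ)..s, g t) =ᵐ[volume.restrict I] fun _ => c := by
    refine ae_eq_of_integral_smul_eq hul
      (continuous_const.locallyIntegrable.locallyIntegrableOn I) fun φ hφ => ?_
    -- `φ` and `(∫ φ) χ` differ by the derivative of a test function
    have hi := fun {φ} (hφ : IsTestFunction φ) => hφ.1.continuous.integrable_of_hasCompactSupport
      (μ := volume) hφ.2.1
    obtain ⟨Φ, hΦ, hΦd⟩ := (hφ.sub_const_mul hχ (∫ s, φ s)).exists_primitive (by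
      rw [integral_sub (hi hφ) ((hi hχ).const_mul _), integral_const_mul, hχ1, mul_one, sub_self])
    have e₁ : ∫ s in I, deriv Φ s • (u s - ∫ t in (0 : ℝ)..s, g t) = 0 := by
      simp only [smul_sub]
      rw [integral_sub (hΦ.deriv.integrableOn_smul h.1) (hΦ.deriv.integrableOn_smul hcl),
        integral_deriv_smul_primitive hΦ hg, ← iteratedDeriv_one, h.2.2 Φ hΦ]
      simp
    rw [hΦd] at e₁
    simp only [sub_smul, mul_smul] at e₁
    have hχi : IntegrableOn (fun s => (∫ t, φ t) • χ s • (u s - ∫ t in (0 : ℝ)..s, g t)) I :=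
      (hχ.integrableOn_smul hul).smul (∫ t, φ t)
    rw [integral_sub (hφ.integrableOn_smul hul) hχi, integral_smul, sub_eq_zero] at e₁
    rw [integral_smul_const, hφ.setIntegral_eq]
    exact e₁
  refine ⟨c, key.mono fun s hs => ?_⟩
  exact sub_eq_iff_eq_add.1 hs

theorem isWeakDeriv_of_contDiff {k : ℕ} {V : ℝ → E3} (hV : ContDiff ℝ k V) :
    IsWeakDeriv k V (iteratedDeriv k V) := by
  refine ⟨hV.continuous.locallyIntegrable.locallyIntegrableOn I,
    (hV.continuous_iteratedDeriv k le_rfl).locallyIntegrable.locallyIntegrableOn I, ?_⟩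
  have hI (f : ℝ → E3) : ∫ s in I, f s = ∫ s in (0 : ℝ)..1, f s := by
    rw [intervalIntegral.integral_of_le zero_le_one, integral_Ioc_eq_integral_Ioo, I]
  induction k with
  | zero => simp
  | succ k ih =>
    intro φ hφ
    have hV' := hV.of_le (m := (k : ℕ∞ω)) (by exact_mod_cast k.le_succ)
    have hd := hV.differentiable_iteratedDeriv k (by exact_mod_cast k.lt_succ_self)
    have hc := hV.continuous_iteratedDeriv (k + 1) le_rfl
    rw [iteratedDeriv_succ', ih hV' _ hφ.deriv, hI, hI, iteratedDeriv_succ]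
    rw [iteratedDeriv_succ] at hc
    rw [intervalIntegral.integral_smul_deriv_eq_deriv_smul (u' := deriv φ)
      (fun s _ => ((hφ.1.differentiable (by simp)) s).hasDerivAt) (fun s _ => (hd s).hasDerivAt)
      (hφ.deriv.1.continuous.intervalIntegrable _ _) (hc.intervalIntegrable _ _),
      hφ.apply_zero, hφ.apply_one, pow_succ]
    simp

theorem weakDeriv_ae_eq {k : ℕ} {u V : ℝ → E3} (hV : ContDiff ℝ k V)
    (h : u =ᵐ[volume.restrict I] V) :
    weakDeriv k u =ᵐ[volume.restrict I] iteratedDeriv k V := by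
  have hw : IsWeakDeriv k u (iteratedDeriv k V) :=
    (isWeakDeriv_of_contDiff hV).congr_left h.symm
  have hex : ∃ g, IsWeakDeriv k u g := ⟨_, hw⟩
  rw [weakDeriv, dif_pos hex]
  exact hex.choose_spec.ae_eq hw

/-- The embedding `H^{n+1}(I) ⊆ Cⁿ([0,1])`. The representative is extended to the whole line. -/
theorem MemH.exists_contDiff {n : ℕ} {u : ℝ → E3} (hu : MemH (n + 1) u) :
    ∃ V, ContDiff ℝ n V ∧ u =ᵐ[volume.restrict I] V := by
  induction n generalizing u with
  | zero =>
    obtain ⟨g, hg, hg2⟩ := hu 1 le_rfl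
    have hgi : Integrable (I.indicator g) := by
      rw [integrable_indicator_iff (by exact measurableSet_Ioo)]
      have : IsFiniteMeasure (volume.restrict I) := ⟨by simp [I]⟩
      exact hg2.integrable one_le_two
    have hae : g =ᵐ[volume.restrict I] I.indicator g :=
      (indicator_ae_eq_restrict (by exact measurableSet_Ioo)).symm
    have hg' : IsWeakDeriv 1 u (I.indicator g) := by
      refine ⟨hg.1, hg.2.1.congr hae, fun φ hφ => ?_⟩
      rw [hg.2.2 φ hφ]
      congr 1
      exact integral_congr_ae (hae.mono fun s hs => by simp only [hs])
    obtain ⟨c, hc⟩ := hg'.ae_eq_primitive fun a b => hgi.intervalIntegrable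
    refine ⟨_, ?_, hc⟩
    rw [Nat.cast_zero, contDiff_zero]
    exact continuous_const.add
      (intervalIntegral.continuous_primitive (fun a b => hgi.intervalIntegrable) 0)
  | succ n ih =>
    obtain ⟨g, hg, -⟩ := hu 1 (by omega)
    obtain ⟨G, hG, hgG⟩ := ih (u := g) fun k hk => by
      obtain ⟨w, hw, hw2⟩ := hu (k + 1) (by omega)
      exact ⟨w, hg.of_succ hw, hw2⟩
    have hg' : IsWeakDeriv 1 u G := by
      refine ⟨hg.1, hg.2.1.congr hgG, fun φ hφ => ?_⟩
      rw [hg.2.2 φ hφ]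
      congr 1
      exact integral_congr_ae (hgG.mono fun s hs => by simp only [hs])
    obtain ⟨c, hc⟩ := hg'.ae_eq_primitive fun a b => hG.continuous.intervalIntegrable a b
    have hd (s : ℝ) : HasDerivAt (fun s => c + ∫ t in (0 : ℝ)..s, G t) (G s) s :=
      (intervalIntegral.integral_hasDerivAt_right (hG.continuous.intervalIntegrable _ _)
        (hG.continuous.stronglyMeasurableAtFilter _ _) hG.continuous.continuousAt).const_add c
    refine ⟨_, contDiff_natSucc_iff.2 ⟨fun s => (hd s).differentiableAt, ?_⟩, hc⟩
    rw [funext fun s => (hd s).deriv]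
    exact hG

theorem hasTrace_iff {u W : ℝ → E3} {p : ℝ} {c : E3} (hW : Continuous W)
    (h : u =ᵐ[volume.restrict I] W) (hp : p ∈ Icc (0 : ℝ) 1) : HasTrace u p c ↔ W p = c := by
  constructor
  · rintro ⟨w, hw, huw, rfl⟩
    have : W =ᵐ[volume.restrict (Icc 0 1)] w := by
      rw [← restrict_Ioo_eq_restrict_Icc]
      exact h.symm.trans huw
    exact Measure.eqOn_Icc_of_ae_eq volume zero_ne_one this hW.continuousOn hw hp
  · intro hc
    exact ⟨W, hW.continuousOn, h, hc⟩

theorem normH_zero (n : ℕ) : normH n 0 = 0 := by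
  rw [normH, Finset.sum_eq_zero, Real.sqrt_zero]
  intro k _
  have : weakDeriv k (0 : ℝ → E3) =ᵐ[volume.restrict I] iteratedDeriv k (fun _ => (0 : E3)) :=
    weakDeriv_ae_eq contDiff_const (ae_of_all _ fun _ => rfl)
  rw [integral_congr_ae (g := fun _ => 0)]
  · simp
  · filter_upwards [this] with s hs
    rw [hs]
    simp

theorem Q_ae_eq_classicalQ {k : ℕ} {v V : ℝ → E3} (ε : ℝ) (hV : ContDiff ℝ (2 * k : ℕ) V)
    (h : v =ᵐ[volume.restrict I] V) (j : ℕ) (hj : j ≤ k) :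
    Q ε v j =ᵐ[volume.restrict I] classicalQ ε V j := by
  induction j using Nat.strong_induction_on with
  | _ j ih =>
    cases j with
    | zero => simpa [Q, classicalQ] using h
    | succ j =>
      have h₀ : ∀ᵐ s ∂volume.restrict I, ∀ i ≤ j, Q ε v i s = classicalQ ε V i s :=
        ae_all_iff.2 fun i => eventually_imp_distrib_left.2 fun hi => ih i (by omega) (by omega)
      have hw (r : ℕ) (hr : r ≤ 2) : ∀ᵐ s ∂volume.restrict I, ∀ i ≤ j,
          weakDeriv r (Q ε v i) s = iteratedDeriv r (classicalQ ε V i) s :=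
        ae_all_iff.2 fun i => eventually_imp_distrib_left.2 fun hi =>
          weakDeriv_ae_eq ((contDiff_classicalQ ε hV i (by omega)).of_le
            (by exact_mod_cast (by omega : r ≤ 2 * k - 2 * i))) (ih i (by omega) (by omega))
      filter_upwards [h₀, hw 1 one_le_two, hw 2 le_rfl] with s h₀ h₁ h₂
      simp only [iteratedDeriv_succ, iteratedDeriv_zero] at h₁ h₂
      rw [Q, classicalQ]
      refine congrArg₂ (· + ·) (congrArg₂ (· + ·) ?_ ?_) (congrArg (ε • ·) ?_)
      · refine Finset.sum_congr rfl fun i _ => ?_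
        rw [h₀ i (by omega), h₂ (j - i) (by omega)]
      · rw [h₂ j le_rfl]
      · refine Finset.sum_congr rfl fun i _ => Finset.sum_congr rfl fun l _ => ?_
        rw [h₀ (j - i - l) (by omega), h₁ i (by omega), h₁ l (by omega)]

/-! ### Equivalence of the compatibility conditions -/

theorem P_eq_Q_zero (v : ℝ → E3) (k : ℕ) : P v k = Q 0 v k := by
  induction k using Nat.strong_induction_on with
  | _ k ih =>
    cases k with
    | zero => rw [P, Q]
    | succ k =>
      funext s
      rw [P, Q]
      simp only [zero_smul, add_zero]
      refine Finset.sum_congr rfl fun i _ => ?_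
      rw [ih i (by omega), ih (k - i) (by omega)]

/-- For fields of unit length, the compatibility conditions of the limiting problem up to order `m`
imply those of the regularized problem up to order `m`. -/
theorem CompatUpTo.regCompatUpTo {a : E3} {m : ℕ} {v : ℝ → E3} (ha : ‖a‖ = 1)
    (hunit : IsUnitField v) (h : CompatUpTo a v m) (ε : ℝ) : RegCompatUpTo ε a v m := by
  obtain ⟨V, hV, hvV⟩ := (h m le_rfl).1.exists_contDiff
  have h01 : (0 : ℝ) ∈ Icc (0 : ℝ) 1 := by simp
  have h11 : (1 : ℝ) ∈ Icc (0 : ℝ) 1 := by simp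
  have hVunit : ∀ s ∈ Ioo (0 : ℝ) 1, ‖V s‖ = 1 := by
    have hae : (fun s => ‖V s‖) =ᵐ[volume.restrict (Ioo 0 1)] fun _ => 1 := by
      filter_upwards [hunit, hvV] with s h₁ h₂
      rw [← h₂, h₁]
    exact Measure.eqOn_Ioo_of_ae_eq volume hae hV.continuous.norm.continuousOn continuousOn_const
  have hend := (h 0 m.zero_le).2
  rw [if_pos rfl, hasTrace_iff hV.continuous hvV h01, hasTrace_iff hV.continuous hvV h11] at hend
  have htr (δ : ℝ) (k : ℕ) (hk : k ≤ m) {p : ℝ} (hp : p ∈ Icc (0 : ℝ) 1) :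
      HasTrace (Q δ v k) p 0 ↔ classicalQ δ V k p = 0 :=
    hasTrace_iff (contDiff_classicalQ δ hV k hk).continuous (Q_ae_eq_classicalQ δ hV hvV k hk) hp
  have hP (k : ℕ) (hk : 1 ≤ k) (hkm : k ≤ m) :
      classicalQ 0 V k 0 = 0 ∧ classicalQ 0 V k 1 = 0 := by
    have := (h k hkm).2
    rwa [if_neg (by omega), P_eq_Q_zero, htr 0 k hkm h01, htr 0 k hkm h11] at this
  intro k hkm
  refine ⟨(h k hkm).1, ?_⟩
  split_ifs with hk
  · simpa [hk] using (h 0 m.zero_le).2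
  · have he3 : ‖e3‖ = 1 := by simp [e3]
    rw [htr ε k hkm h01, htr ε k hkm h11]
    exact ⟨classicalQ_eq_zero ha h01 hV hVunit hend.1 (fun i hi him => (hP i hi him).1) ε k
        (by omega) hkm,
      classicalQ_eq_zero he3 h11 hV hVunit hend.2 (fun i hi him => (hP i hi him).2) ε k
        (by omega) hkm⟩

end VortexFilament

end

theorem mainTheorem3 (l : ℕ) :
    ∃ C : ℝ, 0 < C ∧
      ∀ (a : VortexFilament.E3), ‖a‖ = 1 →
      ∀ m : ℕ, m ≤ (l + 3) / 2 →
      ∀ v₀ : ℝ → VortexFilament.E3,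
        VortexFilament.MemH (l + 3) v₀ →
        VortexFilament.IsUnitField v₀ →
        VortexFilament.CompatUpTo a v₀ m →
        ∃ εs : ℝ, 0 < εs ∧ ∃ w : ℝ → ℝ → VortexFilament.E3,
          (∀ ε ∈ Ioc 0 εs,
            VortexFilament.IsUnitField (w ε) ∧
            VortexFilament.MemH (l + 3) (w ε) ∧
            VortexFilament.RegCompatUpTo ε a (w ε) m ∧
            VortexFilament.normH (l + 3) (w ε) ≤ C * VortexFilament.normH (l + 3) v₀) ∧
          Tendsto (fun ε => VortexFilament.normH (l + 3) (w ε - v₀)) (𝓝[>] 0) (𝓝 0) := by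
  -- the datum itself is compatible with the regularized problem, so no correction is needed
  refine ⟨1, one_pos, fun a ha m _ v₀ hv₀ hunit hcompat => ⟨1, one_pos, fun _ => v₀, ?_, ?_⟩⟩
  · exact fun ε _ => ⟨hunit, hv₀, hcompat.regCompatUpTo ha hunit ε, (one_mul _).ge⟩
  · simp only [sub_self, VortexFilament.normH_zero]
    exact tendsto_const_nhds
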